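/- Let $G=(V,E)$ be a finite connected bipartite graph with color classes $R$ and $B$ ($V=R\,\dot\cup\,B$), let $\Gamma$ be a group of automorphisms of $G$, and let $L=(\ell_1,\dots,\ell_k)$ be a sequence of distinct nodes of $G$ (the leaders; for instance an enumeration of all of $V$). For $\ell=\ell_i\in L$ let $O_\ell$ be the orbit of $\ell$ under the pointwise stabilizer of $\{\ell_1,\dots,\ell_{i-1}\}$ in $\Gamma$; the nodes $f\in O_\ell\setminus\{\ell\}$ are the followers of $\ell$. Let $S=S(L)=\{(\ell,f):\ell\in L,\ f\in O_\ell\setminus\{\ell\}\}$. The SST cut of $(\ell,f)\in S$ is the inequality $-x_\ell+x_f\le 0$, and $\mathcal K(S)\subseteq\mathbb R^V$ is the set of points that satisfy all SST cuts in $S$. Let $P(G)=\operatorname{conv}\{x\in\{0,1\}^V : x_u+x_v\le 1 \text{ for all } \{u,v\}\in E\}$ and $P(G,S)=\operatorname{conv}\{x\in\{0,1\}^V : x\in P(G)\cap\mathcal K(S)\}$. Let $Q$ be the set of all $x\in\mathbb R^V$ that satisfy the box constraints $0\le x_v\le 1$ for $v\in V$, the edge inequalities $x_u+x_v\le 1$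 for $\{u,v\}\in E$, and the SST cuts in $S$. Then: 1. $P(G,S)=Q$ (that is, $P(G,S)$ is completely described by box constraints, edge inequalities, and SST cuts) if and only if every orbit $O_\ell$, $\ell\in L$, contains only nodes from one color class. 2. If for some $\ell\in L$ the orbit $O_\ell$ contains nodes from both color classes, then there are a node $f\in O_\ell$ and an induced path in $G$ from $\ell$ to $f$ with an even number of nodes. 3. For every $\ell\in L$, $f\in O_\ell$ and every induced path $P$ in $G$ from $\ell$ to $f$ with an even number of nodes, the inequality $-x_\ell+\sum_{v\in V(P)}x_v\le\frac{|V(P)|}{2}-1$ is valid for $P(G,S)$, but it is not implied by the box constraints, edge inequalities, and SST cuts: some point of $Q$ violates it. -/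

import Mathlib

namespace SST

/-- `Γ` is a group of automorphisms of the graph `G`: every permutation in `Γ` preserves adjacency. -/
def IsAutomorphismGroup {V : Type*} (G : SimpleGraph V) (Γ : Subgroup (Equiv.Perm V)) : Prop :=
  ∀ γ ∈ Γ, ∀ u v : V, G.Adj (γ u) (γ v) ↔ G.Adj u v

/-- The pointwise stabilizer in `Γ` of a set `I` of nodes. -/
def pointwiseStabilizer {V : Type*} (Γ : Subgroup (Equiv.Perm V)) (I : Set V) :
    Subgroup (Equiv.Perm V) :=
  Γ ⊓ fixingSubgroup (Equiv.Perm V) I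

/-- The orbit `O_ℓ` of the leader `ℓ = L i` computed by the SST algorithm for the sequence of
leaders `L 0, L 1, …`: the orbit of `L i` under the pointwise stabilizer of all
previous leaders. -/
def leaderOrbit {V : Type*} (Γ : Subgroup (Equiv.Perm V)) {k : ℕ} (L : Fin k ↪ V) (i : Fin k) :
    Set V :=
  MulAction.orbit (pointwiseStabilizer Γ {v | ∃ j : Fin k, j < i ∧ L j = v}) (L i)

/-- `S(L)`: the pairs (leader, follower), where the followers of `ℓ` are the elements of
`O_ℓ` other than `ℓ`. -/
def sstCuts {V : Type*} (Γ : Subgroup (Equiv.Perm V)) {k : ℕ} (L : Fin k ↪ V) : Set (V × V) :=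
  {p | ∃ i : Fin k, p.1 = L i ∧ p.2 ∈ leaderOrbit Γ L i \ {L i}}

/-- The cone `K(S)` defined by the SST cuts `-x_ℓ + x_f ≤ 0`, `(ℓ, f) ∈ S`. -/
def sstCone {V : Type*} (S : Set (V × V)) : Set (V → ℝ) :=
  {x | ∀ p ∈ S, -x p.1 + x p.2 ≤ 0}

/-- The points of `{0,1}^V`. -/
def binaryPoints (V : Type*) : Set (V → ℝ) :=
  {x | ∀ v, x v = 0 ∨ x v = 1}

/-- The points satisfying the box constraints `0 ≤ x_v ≤ 1`. -/
def boxConstraints (V : Type*) : Set (V → ℝ) :=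
  {x | ∀ v, 0 ≤ x v ∧ x v ≤ 1}

/-- The points satisfying the edge inequalities `x_u + x_v ≤ 1`. -/
def edgeInequalities {V : Type*} (G : SimpleGraph V) : Set (V → ℝ) :=
  {x | ∀ u v, G.Adj u v → x u + x v ≤ 1}

/-- The stable set polytope `P(G)`. -/
def stableSetPolytope {V : Type*} (G : SimpleGraph V) : Set (V → ℝ) :=
  convexHull ℝ (binaryPoints V ∩ edgeInequalities G)

/-- `P(G, S)`: the convex hull of the binary points of `P(G) ∩ K(S)`. -/
def sstPolytope {V : Type*} (G : SimpleGraph V) (S : Set (V × V)) : Set (V → ℝ) :=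
  convexHull ℝ (binaryPoints V ∩ (stableSetPolytope G ∩ sstCone S))

/-- The points satisfying all box constraints, all edge inequalities and all SST cuts in `S`. -/
def boxEdgeSST {V : Type*} (G : SimpleGraph V) (S : Set (V × V)) : Set (V → ℝ) :=
  boxConstraints V ∩ edgeInequalities G ∩ sstCone S

/-- `P` is an even induced path from `u` to `v`: no node is repeated, every edge of `G` between
two nodes of `P` is an edge of `P`, and the number of nodes is even. -/
def IsEvenInducedPath {V : Type*} {G : SimpleGraph V} {u v : V} (P : G.Walk u v) : Prop :=
  P.IsPath ∧ P.IsChordless ∧ Even P.support.length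

/-- The points satisfying the path inequality `-x_ℓ + ∑_{v ∈ V(P)} x_v ≤ |V(P)| / 2 - 1` of a
path `P` that starts in `ℓ`. (The list `P.support` enumerates `V(P)` without repetition if `P` is a
path.) -/
def pathInequality {V : Type*} {G : SimpleGraph V} {l f : V} (P : G.Walk l f) : Set (V → ℝ) :=
  {x | -x l + (P.support.map x).sum ≤ (P.support.length : ℝ) / 2 - 1}

end SST

namespace SST

open SimpleGraph

variable {V : Type*} {G : SimpleGraph V}

/-! If every orbit is monochromatic, apply t ↦ t² on one color class and t ↦ 2t − t² on the other.
This and the map with the classes swapped send Q into itself, and each x is the midpoint of its two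
images. So an extreme point has x_v = x_v², and Krein–Milman gives integrality
(`sstPolytope_eq_boxEdgeSST`). If an orbit meets both classes, a shortest path from ℓ to a node of
the opposite class is induced with an even number of nodes. Its inequality is a Chvátal–Gomory cut,
violated by the all-1/2 point of Q. -/

/-! ### Even induced paths -/

theorem isChordless_of_length_eq_dist {u v : V} (p : G.Walk u v) (hp : p.length = G.dist u v) :
    p.IsChordless := by
  classical
  rw [Walk.isChordless_iff_forall_mem_edges]
  induction p with
  | nil =>
    intro a b ha hb hab
    simp only [Walk.support_nil, List.mem_singleton] at ha hb
    exact absurd (ha.trans hb.symm) hab.ne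
  | @cons u w v h p ih =>
    have hp' : p.length = G.dist w v := by
      obtain ⟨q, hq⟩ := p.reachable.exists_walk_length_eq_dist
      have h1 := G.dist_le (Walk.cons h q)
      have h2 := G.dist_le p
      rw [Walk.length_cons] at h1 hp
      omega
    have key : ∀ b ∈ p.support, G.Adj u b → s(u, b) ∈ (Walk.cons h p).edges := by
      intro b hb hub
      have h1 := G.dist_le (Walk.cons hub (p.dropUntil b hb))
      have h2 := congrArg Walk.length (p.take_spec hb)
      rw [Walk.length_cons] at h1 hp
      rw [Walk.length_append] at h2
      -- Jumping from `u` straight to `b` cannot shorten the walk, so `b` is already its second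
      -- node.
      have h3 : (p.takeUntil b hb).length = 0 := by omega
      obtain rfl := Walk.eq_of_length_eq_zero h3
      simp
    intro a b ha hb hab
    rw [Walk.support_cons, List.mem_cons] at ha hb
    rcases ha with rfl | ha
    · rcases hb with rfl | hb
      · exact absurd rfl hab.ne
      · exact key b hb hab
    · rcases hb with rfl | hb
      · rw [Sym2.eq_swap]
        exact key a ha hab.symm
      · rw [Walk.edges_cons]
        exact List.mem_cons_of_mem _ (ih hp' ha hb hab)

theorem mem_iff_mem_iff_even_length {R B : Set V} (hRB : G.IsBipartiteWith R B) {u v : V}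
    (p : G.Walk u v) : (u ∈ R ↔ v ∈ R) ↔ Even p.length := by
  induction p with
  | nil => simp
  | @cons u w v h p ih =>
    have huw : u ∈ R ↔ w ∉ R := by
      have hd := Set.disjoint_left.mp hRB.disjoint
      rcases hRB.mem_of_adj h with ⟨hu, hw⟩ | ⟨hu, hw⟩
      · exact ⟨fun _ hw' => hd hw' hw, fun _ => hu⟩
      · exact ⟨fun hu' => absurd hu (hd hu'), fun hw' => absurd hw hw'⟩
    rw [Walk.length_cons, Nat.even_add_one, ← ih]
    tauto

theorem exists_isEvenInducedPath (hG : G.Connected) {R B : Set V} (hRB : G.IsBipartiteWith R B)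
    {l f : V} (hlf : ¬ (l ∈ R ↔ f ∈ R)) : ∃ P : G.Walk l f, IsEvenInducedPath P := by
  obtain ⟨P, hP, hlen⟩ := hG.exists_path_of_dist l f
  refine ⟨P, hP, isChordless_of_length_eq_dist P hlen, ?_⟩
  rw [Walk.length_support, Nat.even_add_one]
  rwa [mem_iff_mem_iff_even_length hRB P] at hlf

theorem exists_mem_not_mem_iff {R B O : Set V} (hcover : R ∪ B = Set.univ)
    (hO : ¬ (O ⊆ R ∨ O ⊆ B)) (l : V) : ∃ f ∈ O, ¬ (l ∈ R ↔ f ∈ R) := by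
  rw [not_or, Set.not_subset, Set.not_subset] at hO
  obtain ⟨⟨a, haO, haR⟩, b, hbO, hbB⟩ := hO
  have hbR : b ∈ R := (hcover.symm ▸ Set.mem_univ b : b ∈ R ∪ B).resolve_right hbB
  by_cases hl : l ∈ R
  · exact ⟨a, haO, by tauto⟩
  · exact ⟨b, hbO, by tauto⟩

/-! ### Path inequalities -/

/-- Half the sum of the edge inequalities along the walk; the two ends are each counted only half.
-/
theorem sum_support_le {x : V → ℝ} (hx : x ∈ edgeInequalities G) {u v : V} (p : G.Walk u v) :
    (p.support.map x).sum ≤ (p.length : ℝ) / 2 + (x u + x v) / 2 := by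
  induction p with
  | nil => simp
  | cons h p ih =>
    have := hx _ _ h
    simp only [Walk.support_cons, List.map_cons, List.sum_cons, Walk.length_cons, Nat.cast_add,
      Nat.cast_one]
    linarith

theorem exists_int_eq_sum {x : V → ℝ} (hx : x ∈ binaryPoints V) (s : List V) :
    ∃ n : ℤ, (s.map x).sum = n := by
  induction s with
  | nil => exact ⟨0, by simp⟩
  | cons a s ih =>
    obtain ⟨n, hn⟩ := ih
    rcases hx a with h | h
    · exact ⟨n, by simp [hn, h]⟩
    · exact ⟨1 + n, by simp [hn, h]⟩

theorem mem_pathInequality_of_mem_binaryPoints {x : V → ℝ} (hb : x ∈ binaryPoints V)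
    (hx : x ∈ edgeInequalities G) {l f : V} (hlf : x f ≤ x l) (P : G.Walk l f)
    (hP : Even P.support.length) : x ∈ pathInequality P := by
  have hsum := sum_support_le hx P
  obtain ⟨n, hn⟩ := exists_int_eq_sum hb P.support
  obtain ⟨a, ha⟩ := exists_int_eq_sum hb [l]
  rw [List.map_singleton, List.sum_singleton] at ha
  obtain ⟨m, hm⟩ := hP
  have hlen : (P.length : ℝ) + 1 = m + m := by
    rw [Walk.length_support] at hm
    exact_mod_cast hm
  -- With x_f ≤ x_ℓ the real bound is m − 1/2; integrality rounds it down to m − 1.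
  have hlt : ((n - a : ℤ) : ℝ) < (m : ℤ) := by
    push_cast
    rw [← hn, ← ha]
    linarith
  have hle : n - a ≤ m - 1 := Int.le_sub_one_of_lt (Int.cast_lt.mp hlt)
  have hle' : (n : ℝ) - a ≤ m - 1 := by exact_mod_cast hle
  change -x l + (P.support.map x).sum ≤ (P.support.length : ℝ) / 2 - 1
  rw [hn, ha, hm]
  push_cast
  linarith

theorem convex_edgeInequalities : Convex ℝ (edgeInequalities G) := by
  intro x hx y hy a b ha hb hab u v huv
  have h1 := mul_le_mul_of_nonneg_left (hx u v huv) ha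
  have h2 := mul_le_mul_of_nonneg_left (hy u v huv) hb
  simp only [Pi.add_apply, Pi.smul_apply, smul_eq_mul]
  linarith

theorem convex_boxConstraints : Convex ℝ (boxConstraints V) := by
  intro x hx y hy a b ha hb hab v
  exact convex_Icc (0 : ℝ) 1 (hx v) (hy v) ha hb hab

theorem convex_sstCone (S : Set (V × V)) : Convex ℝ (sstCone S) := by
  intro x hx y hy a b ha hb hab p hp
  have h1 := mul_le_mul_of_nonneg_left (hx p hp) ha
  have h2 := mul_le_mul_of_nonneg_left (hy p hp) hb
  simp only [Pi.add_apply, Pi.smul_apply, smul_eq_mul]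
  linarith

theorem convex_boxEdgeSST (S : Set (V × V)) : Convex ℝ (boxEdgeSST G S) :=
  (convex_boxConstraints.inter convex_edgeInequalities).inter (convex_sstCone S)

theorem sum_map_add (s : List V) (x y : V → ℝ) (a b : ℝ) :
    (s.map (a • x + b • y)).sum = a * (s.map x).sum + b * (s.map y).sum := by
  induction s with
  | nil => simp
  | cons c s ih =>
    simp only [List.map_cons, List.sum_cons, ih, Pi.add_apply, Pi.smul_apply, smul_eq_mul]
    ring

theorem convex_pathInequality {l f : V} (P : G.Walk l f) : Convex ℝ (pathInequality P) := by
  intro x hx y hy a b ha hb hab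
  have h1 := mul_le_mul_of_nonneg_left hx ha
  have h2 := mul_le_mul_of_nonneg_left hy hb
  change -(a * x l + b * y l) + (P.support.map (a • x + b • y)).sum ≤ _
  rw [sum_map_add]
  obtain rfl : b = 1 - a := by linarith
  linarith

theorem stableSetPolytope_subset : stableSetPolytope G ⊆ edgeInequalities G :=
  convexHull_min Set.inter_subset_right convex_edgeInequalities

theorem binaryPoints_subset : binaryPoints V ⊆ boxConstraints V := by
  intro x hx v
  rcases hx v with h | h <;> simp [h]

theorem binaryPoints_inter_eq (S : Set (V × V)) :
    binaryPoints V ∩ (stableSetPolytope G ∩ sstCone S) = binaryPoints V ∩ boxEdgeSST G S := by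
  ext x
  constructor
  · rintro ⟨hb, hs, hc⟩
    exact ⟨hb, ⟨binaryPoints_subset hb, stableSetPolytope_subset hs⟩, hc⟩
  · rintro ⟨hb, ⟨-, he⟩, hc⟩
    exact ⟨hb, subset_convexHull ℝ _ ⟨hb, he⟩, hc⟩

theorem sstPolytope_eq (S : Set (V × V)) :
    sstPolytope G S = convexHull ℝ (binaryPoints V ∩ boxEdgeSST G S) := by
  rw [sstPolytope, binaryPoints_inter_eq]

theorem le_of_mem_leaderOrbit {Γ : Subgroup (Equiv.Perm V)} {k : ℕ} {L : Fin k ↪ V} {x : V → ℝ}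
    (hx : x ∈ sstCone (sstCuts Γ L)) {i : Fin k} {f : V} (hf : f ∈ leaderOrbit Γ L i) :
    x f ≤ x (L i) := by
  by_cases hfl : f = L i
  · rw [hfl]
  · have : -x (L i) + x f ≤ 0 := hx (L i, f) ⟨i, rfl, hf, hfl⟩
    linarith

theorem sstPolytope_subset_pathInequality {Γ : Subgroup (Equiv.Perm V)} {k : ℕ} {L : Fin k ↪ V}
    {i : Fin k} {f : V} (hf : f ∈ leaderOrbit Γ L i) {P : G.Walk (L i) f}
    (hP : IsEvenInducedPath P) : sstPolytope G (sstCuts Γ L) ⊆ pathInequality P := by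
  rw [sstPolytope_eq]
  refine convexHull_min ?_ (convex_pathInequality P)
  rintro x ⟨hb, ⟨-, he⟩, hc⟩
  exact mem_pathInequality_of_mem_binaryPoints hb he (le_of_mem_leaderOrbit hc hf) P hP.2.2

theorem not_boxEdgeSST_subset_pathInequality (S : Set (V × V)) {l f : V} (P : G.Walk l f) :
    ¬ boxEdgeSST G S ⊆ pathInequality P := by
  intro h
  have hmem : (fun _ => 1 / 2 : V → ℝ) ∈ boxEdgeSST G S := by
    refine ⟨⟨fun v => ?_, fun u v _ => ?_⟩, fun p _ => ?_⟩ <;> norm_num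
  have h' : -(1 / 2 : ℝ) + (P.support.map fun _ => (1 / 2 : ℝ)).sum ≤
      (P.support.length : ℝ) / 2 - 1 := h hmem
  rw [List.map_const', List.sum_replicate, nsmul_eq_mul] at h'
  linarith

/-! ### Integrality for monochromatic orbits -/

theorem isCompact_boxEdgeSST (S : Set (V × V)) : IsCompact (boxEdgeSST G S) := by
  have hbox : IsCompact (boxConstraints V) := by
    have : boxConstraints V = Set.univ.pi fun _ => Set.Icc (0 : ℝ) 1 := by
      ext x
      exact (Set.mem_univ_pi (t := fun _ => Set.Icc (0 : ℝ) 1)).symm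
    rw [this]
    exact isCompact_univ_pi fun _ => isCompact_Icc
  have hedge : IsClosed (edgeInequalities G) := by
    simp only [edgeInequalities, Set.ofPred_forall]
    exact isClosed_iInter fun u => isClosed_iInter fun v => isClosed_iInter fun _ =>
      isClosed_le (by fun_prop) continuous_const
  have hcone : IsClosed (sstCone S) := by
    simp only [sstCone, Set.ofPred_forall]
    exact isClosed_iInter fun p => isClosed_iInter fun _ =>
      isClosed_le (by fun_prop) continuous_const
  exact (hbox.inter_right hedge).inter_right hcone

open Classical in
/-- The map `t ↦ t ^ 2` on the coordinates in `R` and its reflection `t ↦ 1 - (1 - t) ^ 2` on the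
other coordinates. -/
noncomputable def squareOn (R : Set V) (x : V → ℝ) : V → ℝ :=
  fun v => if v ∈ R then x v ^ 2 else 2 * x v - x v ^ 2

theorem squareOn_of_mem {R : Set V} {v : V} (hv : v ∈ R) (x : V → ℝ) :
    squareOn R x v = x v ^ 2 := if_pos hv

theorem squareOn_of_notMem {R : Set V} {v : V} (hv : v ∉ R) (x : V → ℝ) :
    squareOn R x v = 2 * x v - x v ^ 2 := if_neg hv

/-- Both maps are increasing on [0,1], and the two ends of an SST cut get the same one. On an edge,
x_u ≤ 1 − x_v squares to x_u² ≤ (1 − x_v)², the edge inequality for the image. -/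
theorem squareOn_mem_boxEdgeSST {R B : Set V} (hRB : G.IsBipartiteWith R B) {S : Set (V × V)}
    (hS : ∀ p ∈ S, p.1 ∈ R ↔ p.2 ∈ R) {x : V → ℝ} (hx : x ∈ boxEdgeSST G S) :
    squareOn R x ∈ boxEdgeSST G S := by
  obtain ⟨⟨hb, he⟩, hc⟩ := hx
  have hd := Set.disjoint_right.mp hRB.disjoint
  have hedge : ∀ u v, G.Adj u v → u ∈ R → v ∈ B → squareOn R x u + squareOn R x v ≤ 1 := by
    intro u v huv hu hv
    rw [squareOn_of_mem hu, squareOn_of_notMem (hd hv)]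
    nlinarith [he u v huv, hb u, hb v]
  refine ⟨⟨fun v => ?_, fun u v huv => ?_⟩, fun p hp => ?_⟩
  · obtain ⟨h0, h1⟩ := hb v
    by_cases hv : v ∈ R
    · rw [squareOn_of_mem hv]
      constructor <;> nlinarith
    · rw [squareOn_of_notMem hv]
      constructor <;> nlinarith
  · rcases hRB.mem_of_adj huv with ⟨hu, hv⟩ | ⟨hu, hv⟩
    · exact hedge u v huv hu hv
    · rw [add_comm]
      exact hedge v u huv.symm hv hu
  · have h := hc p hp
    obtain ⟨h10, h11⟩ := hb p.1
    obtain ⟨h20, h21⟩ := hb p.2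
    by_cases hv : p.1 ∈ R
    · rw [squareOn_of_mem hv, squareOn_of_mem ((hS p hp).mp hv)]
      nlinarith
    · rw [squareOn_of_notMem hv, squareOn_of_notMem (mt (hS p hp).mpr hv)]
      nlinarith

theorem extremePoints_boxEdgeSST_subset {R B : Set V} (hRB : G.IsBipartiteWith R B)
    (hcover : R ∪ B = Set.univ) {S : Set (V × V)} (hS : ∀ p ∈ S, p.1 ∈ R ↔ p.2 ∈ R) :
    (boxEdgeSST G S).extremePoints ℝ ⊆ binaryPoints V ∩ boxEdgeSST G S := by
  intro x hx
  refine ⟨fun v => ?_, hx.1⟩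
  have hB : ∀ v, v ∈ B ↔ v ∉ R := fun v =>
    ⟨fun hv => Set.disjoint_right.mp hRB.disjoint hv,
      (hcover.symm ▸ Set.mem_univ v : v ∈ R ∪ B).resolve_left⟩
  have hS' : ∀ p ∈ S, p.1 ∈ B ↔ p.2 ∈ B := fun p hp => by rw [hB, hB, hS p hp]
  have hmid : x ∈ openSegment ℝ (squareOn R x) (squareOn B x) := by
    refine ⟨1 / 2, 1 / 2, by norm_num, by norm_num, by norm_num, funext fun w => ?_⟩
    simp only [Pi.add_apply, Pi.smul_apply, smul_eq_mul]
    by_cases hw : w ∈ R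
    · rw [squareOn_of_mem hw, squareOn_of_notMem (fun h => (hB w).mp h hw)]
      ring
    · rw [squareOn_of_notMem hw, squareOn_of_mem ((hB w).mpr hw)]
      ring
  have heq := congrFun (hx.2 (squareOn_mem_boxEdgeSST hRB hS hx.1)
    (squareOn_mem_boxEdgeSST hRB.symm hS' hx.1) hmid) v
  have hmul : x v * (x v - 1) = 0 := by
    by_cases hv : v ∈ R
    · rw [squareOn_of_mem hv] at heq
      linarith
    · rw [squareOn_of_notMem hv] at heq
      linarith
  rcases mul_eq_zero.mp hmul with h | h
  · exact Or.inl h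
  · exact Or.inr (sub_eq_zero.mp h)

theorem finite_binaryPoints [Finite V] : (binaryPoints V).Finite := by
  exact Set.Finite.pi' fun _ => Set.toFinite ({0, 1} : Set ℝ)

theorem sstPolytope_eq_boxEdgeSST [Finite V] {R B : Set V} (hRB : G.IsBipartiteWith R B)
    (hcover : R ∪ B = Set.univ) {S : Set (V × V)} (hS : ∀ p ∈ S, p.1 ∈ R ↔ p.2 ∈ R) :
    sstPolytope G S = boxEdgeSST G S := by
  rw [sstPolytope_eq]
  refine (convexHull_min Set.inter_subset_right (convex_boxEdgeSST S)).antisymm ?_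
  -- Finiteness of the binary points disposes of the closure in Krein–Milman.
  have hclosed : IsClosed (convexHull ℝ (binaryPoints V ∩ boxEdgeSST G S)) :=
    (finite_binaryPoints.subset Set.inter_subset_left).isClosed_convexHull ℝ
  calc boxEdgeSST G S = closure (convexHull ℝ ((boxEdgeSST G S).extremePoints ℝ)) :=
        (closure_convexHull_extremePoints (isCompact_boxEdgeSST S) (convex_boxEdgeSST S)).symm
    _ ⊆ convexHull ℝ (binaryPoints V ∩ boxEdgeSST G S) :=
        closure_minimal (convexHull_mono (extremePoints_boxEdgeSST_subset hRB hcover hS)) hclosed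

theorem mem_iff_mem_of_mem_sstCuts {R B : Set V} (hdisj : Disjoint R B)
    {Γ : Subgroup (Equiv.Perm V)} {k : ℕ} {L : Fin k ↪ V}
    (h : ∀ i : Fin k, leaderOrbit Γ L i ⊆ R ∨ leaderOrbit Γ L i ⊆ B) :
    ∀ p ∈ sstCuts Γ L, p.1 ∈ R ↔ p.2 ∈ R := by
  rintro ⟨l, f⟩ ⟨i, rfl : l = L i, hf, -⟩
  have hl : L i ∈ leaderOrbit Γ L i := MulAction.mem_orbit_self _
  have hd := Set.disjoint_right.mp hdisj
  rcases h i with h | h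
  · exact iff_of_true (h hl) (h hf)
  · exact iff_of_false (hd (h hl)) (hd (h hf))

end SST

theorem corollary5 {V : Type*} [Fintype V] (G : SimpleGraph V) (hG : G.Connected)
    (R B : Set V) (hRB : G.IsBipartiteWith R B) (hcover : R ∪ B = Set.univ)
    (Γ : Subgroup (Equiv.Perm V)) (hΓ : SST.IsAutomorphismGroup G Γ)
    {k : ℕ} (L : Fin k ↪ V) :
    (SST.sstPolytope G (SST.sstCuts Γ L) = SST.boxEdgeSST G (SST.sstCuts Γ L) ↔
      ∀ i : Fin k, SST.leaderOrbit Γ L i ⊆ R ∨ SST.leaderOrbit Γ L i ⊆ B) ∧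
    (∀ i : Fin k, ¬ (SST.leaderOrbit Γ L i ⊆ R ∨ SST.leaderOrbit Γ L i ⊆ B) →
      ∃ f ∈ SST.leaderOrbit Γ L i, ∃ P : G.Walk (L i) f, SST.IsEvenInducedPath P) ∧
    (∀ i : Fin k, ∀ f ∈ SST.leaderOrbit Γ L i, ∀ P : G.Walk (L i) f, SST.IsEvenInducedPath P →
      SST.sstPolytope G (SST.sstCuts Γ L) ⊆ SST.pathInequality P ∧
      ¬ SST.boxEdgeSST G (SST.sstCuts Γ L) ⊆ SST.pathInequality P) := by
  have hpath : ∀ i : Fin k, ¬ (SST.leaderOrbit Γ L i ⊆ R ∨ SST.leaderOrbit Γ L i ⊆ B) →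
      ∃ f ∈ SST.leaderOrbit Γ L i, ∃ P : G.Walk (L i) f, SST.IsEvenInducedPath P := by
    intro i hi
    obtain ⟨f, hf, hne⟩ := SST.exists_mem_not_mem_iff hcover hi (L i)
    exact ⟨f, hf, SST.exists_isEvenInducedPath hG hRB hne⟩
  refine ⟨⟨fun heq i => ?_, fun h => ?_⟩, hpath, fun i f hf P hP => ?_⟩
  · by_contra hi
    obtain ⟨f, hf, P, hP⟩ := hpath i hi
    exact SST.not_boxEdgeSST_subset_pathInequality _ P
      (heq ▸ SST.sstPolytope_subset_pathInequality hf hP)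
  · exact SST.sstPolytope_eq_boxEdgeSST hRB hcover (SST.mem_iff_mem_of_mem_sstCuts hRB.disjoint h)
  · exact ⟨SST.sstPolytope_subset_pathInequality hf hP,
      SST.not_boxEdgeSST_subset_pathInequality _ P⟩
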